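/- Let $G$ and $H$ be Polish groups, i.e. topological groups whose topology is separable and completely metrizable. Call a Polish group TSI if it admits a compatible metric $d$ (one inducing its topology) that is two-sided invariant, i.e. $d(gx,gy)=d(x,y)=d(xg,yg)$ for all $g,x,y$. For a Polish group $K$, let $E(K)$ be the equivalence relation on $K^\omega$ given by $$x\,E(K)\,y\iff \lim_{n} x(n)y(n)^{-1}\text{ converges in }K.$$ If $H$ is TSI but $G$ is not, then $E(G)$ is not Borel reducible to $E(H)$, i.e. there is no Borel map $\theta:G^\omega\to H^\omega$ such that, for all $x,y\in G^\omega$, $x\,E(G)\,y\iff\theta(x)\,E(H)\,\theta(y)$. Here $G^\omega$ and $H^\omega$ carry the product topologies. -/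

import Mathlib

open Filter Topology

/-- The equivalence relation `E(G)` on the space of sequences of a topological group `G`:
`x` and `y` are equivalent when `x(n) y(n)⁻¹` converges in `G`. -/
def inducedSetoid (G : Type*) [Group G] [TopologicalSpace G] [IsTopologicalGroup G] :
    Setoid (ℕ → G) where
  r x y := ∃ g : G, Tendsto (fun n => x n * (y n)⁻¹) atTop (𝓝 g)
  iseqv :=
    { refl := fun x => ⟨1, by simp [tendsto_const_nhds]⟩
      symm := by
        rintro x y ⟨g, hg⟩
        exact ⟨g⁻¹, by simpa using hg.inv⟩
      trans := by
        rintro x y z ⟨g, hg⟩ ⟨h, hh⟩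
        exact ⟨g * h, by simpa [mul_assoc] using hg.mul hh⟩ }

/-- `E` is Borel reducible to `F`: some Borel map `f : X → Y` satisfies
`x E y ↔ f x F f y` for all `x` and `y`. -/
def BorelReducible {X Y : Type*} [TopologicalSpace X] [TopologicalSpace Y]
    (E : Setoid X) (F : Setoid Y) : Prop :=
  ∃ f : X → Y, @Measurable X Y (borel X) (borel Y) f ∧ ∀ x y : X, E x y ↔ F (f x) (f y)

/-- The topological group `G` is TSI: it admits a compatible two-sided invariant metric. -/
def IsTSI (G : Type*) [Group G] [t : TopologicalSpace G] : Prop :=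
  ∃ m : MetricSpace G, m.toUniformSpace.toTopologicalSpace = t ∧
    (∀ g x y : G, m.dist (g * x) (g * y) = m.dist x y) ∧
    (∀ g x y : G, m.dist (x * g) (y * g) = m.dist x y)

/-!
If `G` is not TSI, arbitrarily small elements `g` have conjugates `w = h g h⁻¹` outside a fixed
neighbourhood `U` of `1`. Let `θ` be a Borel homomorphism from `E(G)` to `E(H)` and fix a
bi-invariant metric on `H`. Multiplying `x` by a convergent sequence does not change its class, so
Baire category on convergent sequences times `G^ω` shows that multiplying one coordinate of a
generic `x` by a small `g` changes `θ x` into some `u` for which `(θ x)(k) u(k)⁻¹` is nearly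
constant from some `k` on that does not depend on the coordinate. Conjugating by the sequence which
is `h` from some index on, again convergent, gives the same for the large element `w`, and on a
small open set the initial part of `θ x` generically varies little too; a change in a far coordinate
does not leave that set. Iterating along a sparse set of coordinates yields in the limit `y` with
`θ y` equivalent to `θ x`, whereas `y(n) x(n)⁻¹` is `1` at infinitely many `n` and avoids `U` at
infinitely many others.
-/

open TopologicalSpace

section BiinvariantMetric

/-- The supremum over all two-sided translates of the distance truncated at `1`; the truncation
makes the supremum finite. -/
noncomputable def biinvariantDist {G : Type*} [Group G] [PseudoMetricSpace G] (x y : G) : ℝ :=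
  ⨆ p : G × G, min (dist (p.1 * x * p.2) (p.1 * y * p.2)) 1

section PseudoMetric

variable {G : Type*} [Group G] [PseudoMetricSpace G]

theorem min_dist_one_le_biinvariantDist (x y : G) (p : G × G) :
    min (dist (p.1 * x * p.2) (p.1 * y * p.2)) 1 ≤ biinvariantDist x y :=
  le_ciSup (f := fun p : G × G => min (dist (p.1 * x * p.2) (p.1 * y * p.2)) 1)
    ⟨1, by rintro _ ⟨p, rfl⟩; exact min_le_right _ _⟩ p

theorem min_dist_one_le_biinvariantDist_self (x y : G) :
    min (dist x y) 1 ≤ biinvariantDist x y := by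
  simpa using min_dist_one_le_biinvariantDist x y (1, 1)

theorem biinvariantDist_self (x : G) : biinvariantDist x x = 0 := by
  simp [biinvariantDist]

theorem biinvariantDist_comm (x y : G) : biinvariantDist x y = biinvariantDist y x := by
  simp only [biinvariantDist, dist_comm]

theorem biinvariantDist_triangle (x y z : G) :
    biinvariantDist x z ≤ biinvariantDist x y + biinvariantDist y z := by
  refine ciSup_le fun p => ?_
  have htri := dist_triangle (p.1 * x * p.2) (p.1 * y * p.2) (p.1 * z * p.2)
  have hxy := dist_nonneg (x := p.1 * x * p.2) (y := p.1 * y * p.2)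
  have hyz := dist_nonneg (x := p.1 * y * p.2) (y := p.1 * z * p.2)
  refine le_trans ?_ (add_le_add (min_dist_one_le_biinvariantDist x y p)
    (min_dist_one_le_biinvariantDist y z p))
  grind

theorem biinvariantDist_mul_left (g x y : G) :
    biinvariantDist (g * x) (g * y) = biinvariantDist x y :=
  Equiv.iSup_congr ((Equiv.mulRight g).prodCongr (Equiv.refl G)) fun p => by simp [mul_assoc]

theorem biinvariantDist_mul_right (g x y : G) :
    biinvariantDist (x * g) (y * g) = biinvariantDist x y :=
  Equiv.iSup_congr ((Equiv.refl G).prodCongr (Equiv.mulLeft g)) fun p => by simp [mul_assoc]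

theorem dist_lt_of_biinvariantDist_lt {x y : G} {ε : ℝ} (h : biinvariantDist x y < min ε 1) :
    dist x y < ε := by
  have := (min_dist_one_le_biinvariantDist_self x y).trans_lt h
  grind

theorem eventually_biinvariantDist_lt
    (hG : Equicontinuous fun (p : G × G) (x : G) => p.1 * x * p.2) (x : G) {ε : ℝ} (hε : 0 < ε) :
    ∀ᶠ y in 𝓝 x, biinvariantDist x y < ε := by
  filter_upwards [Metric.equicontinuousAt_iff_right.1 (hG x) (ε / 2) (half_pos hε)] with y hy
  exact (ciSup_le fun p => (min_le_left _ _).trans (hy p).le).trans_lt (half_lt_self hε)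

theorem isOpen_iff_biinvariantDist
    (hG : Equicontinuous fun (p : G × G) (x : G) => p.1 * x * p.2) (s : Set G) :
    IsOpen s ↔ ∀ x ∈ s, ∃ ε > 0, ∀ y, biinvariantDist x y < ε → y ∈ s := by
  refine ⟨fun hs x hx => ?_, fun h => isOpen_iff_mem_nhds.2 fun x hx => ?_⟩
  · obtain ⟨ε, hε, hball⟩ := Metric.isOpen_iff.1 hs x hx
    refine ⟨min ε 1, lt_min hε one_pos, fun y hy => hball ?_⟩
    exact Metric.mem_ball'.2 (dist_lt_of_biinvariantDist_lt hy)
  · obtain ⟨ε, hε, hmem⟩ := h x hx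
    exact (eventually_biinvariantDist_lt hG x hε).mono hmem

end PseudoMetric

variable {G : Type*} [Group G]

theorem eq_of_biinvariantDist_eq_zero [MetricSpace G] {x y : G} (h : biinvariantDist x y = 0) :
    x = y :=
  eq_of_forall_dist_le fun _ hε =>
    (dist_lt_of_biinvariantDist_lt (h ▸ lt_min hε one_pos)).le

theorem isTSI_of_equicontinuous [MetricSpace G]
    (hG : Equicontinuous fun (p : G × G) (x : G) => p.1 * x * p.2) : IsTSI G :=
  ⟨MetricSpace.ofDistTopology biinvariantDist biinvariantDist_self biinvariantDist_comm
    biinvariantDist_triangle (isOpen_iff_biinvariantDist hG)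
    (fun _ _ => eq_of_biinvariantDist_eq_zero), rfl, biinvariantDist_mul_left,
    biinvariantDist_mul_right⟩

variable [TopologicalSpace G] [IsTopologicalGroup G] [FirstCountableTopology G] [T0Space G]

theorem isTSI_of_eventually_conjugatesOf_subset
    (hG : ∀ U ∈ 𝓝 (1 : G), ∀ᶠ g in 𝓝 1, conjugatesOf g ⊆ U) : IsTSI G := by
  let : UniformSpace G := IsTopologicalGroup.rightUniformSpace G
  have huniformity : uniformity G = comap (fun p : G × G => p.2 * p.1⁻¹) (𝓝 1) := rfl
  have : (uniformity G).IsCountablyGenerated := by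
    rw [huniformity]; infer_instance
  let : MetricSpace G := UniformSpace.metricSpace G
  refine isTSI_of_equicontinuous fun x V hV => ?_
  obtain ⟨U, hU, hUV⟩ := huniformity ▸ hV
  have hquot : Tendsto (fun y => y * x⁻¹) (𝓝 x) (𝓝 1) := by
    simpa using (continuous_mul_const x⁻¹).tendsto x
  filter_upwards [hquot.eventually (hG U hU)] with y hy p
  exact hUV (hy (isConj_iff.2 ⟨p.1, by group⟩))

theorem exists_seq_isConj_of_not_isTSI (hG : ¬ IsTSI G) :
    ∃ U ∈ 𝓝 (1 : G), ∃ w : ℕ → G, (∀ j, w j ∉ U) ∧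
      ∀ O ∈ 𝓝 (1 : G), ∃ j, ∃ g ∈ O, IsConj g (w j) := by
  obtain ⟨U, hU, hfreq⟩ : ∃ U ∈ 𝓝 (1 : G), ∃ᶠ g in 𝓝 1, ¬ conjugatesOf g ⊆ U := by
    contrapose! hG
    exact isTSI_of_eventually_conjugatesOf_subset (by simpa using hG)
  obtain ⟨g, hg, hgU⟩ := exists_seq_forall_of_frequently hfreq
  choose w hgw hwU using fun j => Set.not_subset.1 (hgU j)
  refine ⟨U, hU, w, hwU, fun O hO => ?_⟩
  obtain ⟨j, hj⟩ := (hg.eventually_mem hO).exists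
  exact ⟨j, g j, hj, hgw j⟩

end BiinvariantMetric

section Generic

variable {X Y : Type*} [TopologicalSpace X]

theorem exists_open_generic_of_subset_iUnion [BaireSpace X] {ι : Type*} [Countable ι]
    {A : ι → Set X} (hA : ∀ i, BaireMeasurableSet (A i)) {V : Set X} (hV : IsOpen V)
    (hne : V.Nonempty) (hcover : V ⊆ ⋃ i, A i) :
    ∃ i, ∃ W ⊆ V, IsOpen W ∧ W.Nonempty ∧ ∀ᶠ x in residual X, x ∈ W → x ∈ A i := by
  choose U hUo hAU using fun i => (hA i).residualEq_isOpen
  have hgeneric : ∀ᶠ x in residual X, ∀ i, (x ∈ A i ↔ x ∈ U i) :=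
    eventually_countable_forall.2 fun i => (hAU i).mem_iff
  obtain ⟨x, hxV, hx⟩ := (dense_of_mem_residual hgeneric).inter_open_nonempty V hV hne
  obtain ⟨i, hi⟩ := Set.mem_iUnion.1 (hcover hxV)
  refine ⟨i, V ∩ U i, Set.inter_subset_left, hV.inter (hUo i), ⟨x, hxV, (hx i).1 hi⟩, ?_⟩
  filter_upwards [hgeneric] with y hy hyW using (hy i).2 hyW.2

theorem eventually_residual_of_forall_open [BaireSpace X] {p : X → Prop}
    (hp : BaireMeasurableSet {x | p x})
    (h : ∀ V : Set X, IsOpen V → V.Nonempty →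
      ∃ W ⊆ V, IsOpen W ∧ W.Nonempty ∧ ∀ᶠ x in residual X, x ∈ W → p x) :
    ∀ᶠ x in residual X, p x := by
  obtain ⟨V, hV, hpV⟩ := hp.compl.residualEq_isOpen
  have hempty : V = ∅ := by
    by_contra hne
    obtain ⟨W, hWV, hW, hWne, hgeneric⟩ := h V hV (Set.nonempty_iff_ne_empty.2 hne)
    obtain ⟨x, hxW, hx, hxp⟩ := (dense_of_mem_residual
      (hgeneric.and hpV.mem_iff)).inter_open_nonempty W hW hWne
    exact hxp.2 (hWV hxW) (hx hxW)
  filter_upwards [hpV.mem_iff] with x hx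
  by_contra hxp
  simpa [hempty] using hx.1 hxp

theorem eventually_residual_image_of_isOpenMap [BaireSpace X] [TopologicalSpace Y] {φ : X → Y}
    (hφ : Continuous φ) (hφo : IsOpenMap φ) {p : Y → Prop} (hp : BaireMeasurableSet {y | p y})
    {Q : Set X} (hQ : IsOpen Q) (h : ∀ᶠ x in residual X, x ∈ Q → p (φ x)) :
    ∀ᶠ y in residual Y, y ∈ φ '' Q → p y := by
  obtain ⟨V, hV, hpV⟩ := hp.compl.residualEq_isOpen
  have hpull : ∀ᶠ x in residual X, (¬ p (φ x) ↔ φ x ∈ V) :=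
    tendsto_residual_of_isOpenMap hφ hφo hpV.mem_iff
  filter_upwards [hpV.mem_iff] with y hy
  rintro ⟨q, hqQ, rfl⟩
  by_contra hpq
  obtain ⟨x, ⟨hxQ, hxV⟩, hx, hxp⟩ := (dense_of_mem_residual
    (h.and hpull)).inter_open_nonempty (Q ∩ φ ⁻¹' V) (hQ.inter (hV.preimage hφ)) ⟨q, hqQ, hy.1 hpq⟩
  exact hxp.2 hxV (hx hxQ)

theorem exists_open_generic_dist_le [BaireSpace X] [MeasurableSpace X] [BorelSpace X]
    [PseudoMetricSpace Y] [SeparableSpace Y] [MeasurableSpace Y] [OpensMeasurableSpace Y]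
    {f : X → Y} (hf : Measurable f) {ε : ℝ} (hε : 0 < ε) {V : Set X} (hV : IsOpen V)
    (hne : V.Nonempty) :
    ∃ y : Y, ∃ W ⊆ V, IsOpen W ∧ W.Nonempty ∧
      ∀ᶠ x in residual X, x ∈ W → dist (f x) y ≤ ε := by
  have : Nonempty Y := hne.to_type.map fun x => f x
  obtain ⟨i, hi⟩ := exists_open_generic_of_subset_iUnion
    (A := fun i => f ⁻¹' Metric.closedBall (denseSeq Y i) ε)
    (fun i => (hf Metric.isClosed_closedBall.measurableSet).baireMeasurableSet) hV hne
    fun x _ => Set.mem_iUnion.2 <| by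
      obtain ⟨i, hi⟩ := (denseRange_denseSeq Y).exists_dist_lt (f x) hε
      exact ⟨i, hi.le⟩
  exact ⟨_, hi⟩

section Translation

variable [Group X] [ContinuousMul X]

theorem eventually_residual_mul_left {p : X → Prop} (hp : ∀ᶠ x in residual X, p x) (a : X) :
    ∀ᶠ x in residual X, p (a * x) :=
  tendsto_residual_of_isOpenMap (continuous_const_mul a) (isOpenMap_mul_left a) hp

theorem exists_residual_subset_mul_left_mem {ι : Type*} [Countable ι] {p : X → Prop}
    (hp : ∀ᶠ x in residual X, p x) (s : ι → X) :
    ∃ S ∈ residual X, (∀ x ∈ S, p x) ∧ ∀ i, ∀ x ∈ S, s i * x ∈ S := by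
  refine ⟨{x | ∀ l : List ι, p ((l.map s).prod * x)},
    eventually_countable_forall.2 fun l => eventually_residual_mul_left hp _,
    fun x hx => by simpa using hx [], fun i x hx l => ?_⟩
  simpa [mul_assoc] using hx (l ++ [i])

end Translation

theorem exists_open_subset_dependsOn_Iio {E : ℕ → Type*} [∀ n, TopologicalSpace (E n)]
    {V : Set (∀ n, E n)} (hV : IsOpen V) (hne : V.Nonempty) :
    ∃ W ⊆ V, IsOpen W ∧ W.Nonempty ∧ ∃ N, DependsOn (· ∈ W) (Set.Iio N) := by
  obtain ⟨x, hx⟩ := hne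
  obtain ⟨I, u, hu, hsub⟩ := isOpen_pi_iff.1 hV x hx
  obtain ⟨N, hN⟩ := I.bddAbove
  refine ⟨(I : Set ℕ).pi u, hsub, isOpen_set_pi I.finite_toSet fun i hi => (hu i hi).1,
    ⟨x, fun i hi => (hu i hi).2⟩, N + 1, fun y z hyz => propext <| forall₂_congr fun i hi => ?_⟩
  rw [hyz i (Nat.lt_succ_of_le (hN hi))]

end Generic

section TailClose

/-- From index `K` on, any two terms of the sequence `u n * (v n)⁻¹` are within `ε`: a
quantitative, closed-condition form of the equivalence of `u` and `v`. -/
def TailClose {H : Type*} [Group H] [Dist H] (K : ℕ) (ε : ℝ) (u v : ℕ → H) : Prop :=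
  ∀ m ≥ K, ∀ k ≥ K, dist (u m * (v m)⁻¹) (u k * (v k)⁻¹) ≤ ε

variable {H : Type*} [Group H] [PseudoMetricSpace H]

theorem TailClose.mono {K L : ℕ} {ε : ℝ} {u v : ℕ → H} (h : TailClose K ε u v) (hKL : K ≤ L) :
    TailClose L ε u v :=
  fun m hm k hk => h m (hKL.trans hm) k (hKL.trans hk)

theorem exists_tailClose_of_inducedSetoid [IsTopologicalGroup H] {u v : ℕ → H}
    (h : inducedSetoid H u v) {ε : ℝ} (hε : 0 < ε) : ∃ K, TailClose K ε u v := by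
  obtain ⟨l, hl⟩ := h
  obtain ⟨K, hK⟩ := Metric.cauchySeq_iff.1 hl.cauchySeq ε hε
  exact ⟨K, fun m hm k hk => (hK m hm k hk).le⟩

section Invariant

variable [IsIsometricSMul Hᵐᵒᵖ H]

theorem TailClose.dist_le {K : ℕ} {ε δ : ℝ} {u v : ℕ → H} (h : TailClose K ε u v)
    (hinit : ∀ k ≤ K, dist (u k) (v k) ≤ δ) (k : ℕ) : dist (u k) (v k) ≤ ε + δ := by
  have hε : 0 ≤ ε := dist_nonneg.trans (h K le_rfl K le_rfl)
  rcases le_total k K with hk | hk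
  · exact (hinit k hk).trans (le_add_of_nonneg_left hε)
  · have hdist : ∀ i, dist (u i) (v i) = dist (u i * (v i)⁻¹) 1 := fun i => by
      rw [← dist_mul_right (u i) (v i) (v i)⁻¹, mul_inv_cancel]
    calc dist (u k) (v k) = dist (u k * (v k)⁻¹) 1 := hdist k
      _ ≤ dist (u k * (v k)⁻¹) (u K * (v K)⁻¹) + dist (u K * (v K)⁻¹) 1 := dist_triangle _ _ _
      _ ≤ ε + δ := add_le_add (h k hk K le_rfl) (hdist K ▸ hinit K le_rfl)

theorem inducedSetoid_of_forall_exists_dist_le [IsTopologicalGroup H] [CompleteSpace H]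
    {u v : ℕ → H}
    (h : ∀ ε > 0, ∃ u', inducedSetoid H u' v ∧ ∀ k, dist (u' k) (u k) ≤ ε) :
    inducedSetoid H u v := by
  refine cauchySeq_tendsto_of_complete (Metric.cauchySeq_iff.2 fun ε hε => ?_)
  obtain ⟨u', hu', hdist⟩ := h (ε / 4) (by positivity)
  obtain ⟨K, hK⟩ := exists_tailClose_of_inducedSetoid hu' (by positivity : 0 < ε / 4)
  have hquot : ∀ k, dist (u' k * (v k)⁻¹) (u k * (v k)⁻¹) ≤ ε / 4 := fun k =>
    (dist_mul_right _ _ _).trans_le (hdist k)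
  refine ⟨K, fun m hm k hk => ?_⟩
  have htri := dist_triangle4_left (u' m * (v m)⁻¹) (u' k * (v k)⁻¹) (u m * (v m)⁻¹)
    (u k * (v k)⁻¹)
  linarith [hK m hm k hk, hquot m, hquot k]

variable [IsIsometricSMul H H]

theorem TailClose.symm {K : ℕ} {ε : ℝ} {u v : ℕ → H} (h : TailClose K ε u v) :
    TailClose K ε v u :=
  fun m hm k hk => by simpa using (dist_inv_inv _ _).trans_le (h m hm k hk)

theorem TailClose.trans {K L : ℕ} {ε δ : ℝ} {u v w : ℕ → H} (h : TailClose K ε u v)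
    (h' : TailClose L δ v w) : TailClose (max K L) (ε + δ) u w := by
  intro m hm k hk
  calc dist (u m * (w m)⁻¹) (u k * (w k)⁻¹)
      = dist (u m * (v m)⁻¹ * (v m * (w m)⁻¹)) (u k * (v k)⁻¹ * (v k * (w k)⁻¹)) := by
        simp only [mul_assoc, inv_mul_cancel_left]
    _ ≤ dist (u m * (v m)⁻¹ * (v m * (w m)⁻¹)) (u k * (v k)⁻¹ * (v m * (w m)⁻¹)) +
          dist (u k * (v k)⁻¹ * (v m * (w m)⁻¹)) (u k * (v k)⁻¹ * (v k * (w k)⁻¹)) :=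
        dist_triangle _ _ _
    _ ≤ ε + δ := by
        rw [dist_mul_right, dist_mul_left]
        exact add_le_add (h.mono (le_max_left K L) m hm k hk)
          (h'.mono (le_max_right K L) m hm k hk)

end Invariant

variable [IsTopologicalGroup H] [SecondCountableTopology H] [MeasurableSpace H] [BorelSpace H]
  {X : Type*} [MeasurableSpace X]

theorem measurableSet_tailClose {u v : X → ℕ → H} (hu : Measurable u) (hv : Measurable v)
    (K : ℕ) (ε : ℝ) : MeasurableSet {x | TailClose K ε (u x) (v x)} := by
  have hmeas : ∀ m, Measurable fun x => u x m * (v x m)⁻¹ := fun m =>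
    (measurable_pi_iff.1 hu m).mul (measurable_pi_iff.1 hv m).inv
  simp only [TailClose, Set.ofPred_forall]
  exact MeasurableSet.iInter fun m => MeasurableSet.iInter fun _ => MeasurableSet.iInter fun k =>
    MeasurableSet.iInter fun _ => measurableSet_le ((hmeas m).dist (hmeas k)) measurable_const

theorem exists_open_generic_tailClose [TopologicalSpace X] [BaireSpace X] [BorelSpace X]
    {u v : X → ℕ → H} (hu : Measurable u) (hv : Measurable v)
    (huv : ∀ x, inducedSetoid H (u x) (v x)) {ε : ℝ} (hε : 0 < ε) {V : Set X} (hV : IsOpen V)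
    (hne : V.Nonempty) :
    ∃ K, ∃ W ⊆ V, IsOpen W ∧ W.Nonempty ∧
      ∀ᶠ x in residual X, x ∈ W → TailClose K ε (u x) (v x) :=
  exists_open_generic_of_subset_iUnion
    (fun K => (measurableSet_tailClose hu hv K ε).baireMeasurableSet) hV hne
    fun x _ => Set.mem_iUnion.2 (exists_tailClose_of_inducedSetoid (huv x) hε)

end TailClose

section ConvergentSeq

/-- The space of convergent sequences with their limits, i.e. of continuous maps on the
one-point compactification of `ℕ`, with the topology of uniform convergence. -/
abbrev ConvergentSeq (G : Type*) [TopologicalSpace G] : Type _ :=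
  C(OnePoint ℕ, G)

namespace ConvergentSeq

variable {G : Type*} [Group G] [TopologicalSpace G]

/-- The sequence which is `g` at `n` and `1` elsewhere, with limit `1`. -/
noncomputable def mulSingle (n : ℕ) (g : G) : ConvergentSeq G :=
  OnePoint.continuousMapMkNat (Pi.mulSingle n g) 1 <| by
    refine tendsto_const_nhds.congr' ((eventually_gt_atTop n).mono fun k hk => ?_)
    simp [Pi.mulSingle_eq_of_ne hk.ne']

theorem eventually_mulSingle_mem [MetrizableSpace G] {R : Set (ConvergentSeq G)}
    (hR : R ∈ 𝓝 1) : ∀ᶠ g in 𝓝 (1 : G), ∀ n, mulSingle n g ∈ R := by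
  let : MetricSpace G := metrizableSpaceMetric G
  obtain ⟨ε, hε, hball⟩ := Metric.mem_nhds_iff.1 hR
  filter_upwards [Metric.ball_mem_nhds (1 : G) hε] with g hg n
  refine hball ((ContinuousMap.dist_lt_iff hε).2 fun k => ?_)
  induction k using OnePoint.rec with
  | infty => exact (dist_self (1 : G)).trans_lt hε
  | coe k =>
    change dist ((Pi.mulSingle n g : ℕ → G) k) 1 < ε
    rcases eq_or_ne k n with rfl | hk
    · simpa using hg
    · simpa [Pi.mulSingle_eq_of_ne hk] using hε

variable [IsTopologicalGroup G]

/-- The homomorphism which forgets the limit of a convergent sequence. -/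
def toSeq : ConvergentSeq G →* (ℕ → G) where
  toFun c n := c (n : OnePoint ℕ)
  map_one' := rfl
  map_mul' _ _ := rfl

theorem toSeq_mulSingle (n : ℕ) (g : G) : toSeq (mulSingle n g) = Pi.mulSingle n g := rfl

theorem tendsto_toSeq (c : ConvergentSeq G) : Tendsto (toSeq c) atTop (𝓝 (c OnePoint.infty)) :=
  (OnePoint.continuous_iff_from_nat c).1 c.continuous

theorem continuous_toSeq : Continuous (toSeq : ConvergentSeq G →* (ℕ → G)) :=
  continuous_pi fun n => continuous_eval_const (n : OnePoint ℕ)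

theorem continuous_toSeq_mul :
    Continuous fun p : ConvergentSeq G × (ℕ → G) => toSeq p.1 * p.2 :=
  (continuous_toSeq.comp continuous_fst).mul continuous_snd

theorem isOpenMap_toSeq_mul :
    IsOpenMap fun p : ConvergentSeq G × (ℕ → G) => toSeq p.1 * p.2 := by
  let shear : ConvergentSeq G × (ℕ → G) ≃ₜ ConvergentSeq G × (ℕ → G) :=
    { toFun := fun p => (p.1, toSeq p.1 * p.2)
      invFun := fun p => (p.1, (toSeq p.1)⁻¹ * p.2)
      left_inv := fun p => by simp
      right_inv := fun p => by simp
      continuous_toFun := continuous_fst.prodMk continuous_toSeq_mul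
      continuous_invFun := continuous_fst.prodMk
        ((continuous_toSeq.comp continuous_fst).inv.mul continuous_snd) }
  exact isOpenMap_snd.comp shear.isOpenMap

instance baireSpace_prod {Z : Type*} [TopologicalSpace Z] [PolishSpace Z] [PolishSpace G] :
    BaireSpace (ConvergentSeq G × Z) := by
  let := upgradeIsCompletelyMetrizable G
  let := upgradeIsCompletelyMetrizable Z
  infer_instance

end ConvergentSeq

end ConvergentSeq

section CompleteSpace

variable {H : Type*} [Group H] [PseudoMetricSpace H] [IsIsometricSMul H H]
  [IsIsometricSMul Hᵐᵒᵖ H]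

theorem eventually_residual_exists_dist_lt_of_cauchySeq {Z : Type*} [PseudoMetricSpace Z]
    {e : H → Z} (he : Continuous e) {h : ℕ → H} (hh : CauchySeq h) {ε : ℝ} (hε : 0 < ε) :
    ∀ᶠ g in residual H, ∃ z, ∀ᶠ n in atTop, dist (e (h n * g)) z < ε := by
  refine mem_of_superset (residual_of_dense_open isOpen_interior ?_) interior_subset
  refine Metric.dense_iff.2 fun g₀ r hr => ?_
  obtain ⟨N, hN⟩ := Metric.cauchySeq_iff'.1 hh r hr
  obtain ⟨η, hη, hball⟩ := Metric.continuous_iff.1 he (h N * g₀) ε hε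
  obtain ⟨M, hM⟩ := Metric.cauchySeq_iff.1 hh (η / 2) (half_pos hη)
  let L := max M N
  refine ⟨(h L)⁻¹ * (h N * g₀), ?_, mem_interior_iff_mem_nhds.2 ?_⟩
  · calc dist ((h L)⁻¹ * (h N * g₀)) g₀ = dist (h N) (h L) := by
          rw [← dist_mul_left (h L), mul_inv_cancel_left, dist_mul_right]
      _ < r := by rw [dist_comm]; exact hN L (le_max_right M N)
  · filter_upwards [Metric.ball_mem_nhds _ (half_pos hη)] with g hg
    refine ⟨e (h N * g₀), (eventually_ge_atTop M).mono fun n hn => hball _ ?_⟩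
    calc dist (h n * g) (h N * g₀)
        ≤ dist (h n * g) (h L * g) + dist (h L * g) (h N * g₀) := dist_triangle _ _ _
      _ = dist (h n) (h L) + dist g ((h L)⁻¹ * (h N * g₀)) := by
        rw [dist_mul_right, ← dist_mul_left (h L) g, mul_inv_cancel_left]
      _ < η / 2 + η / 2 := add_lt_add (hM n hn L (le_max_left M N)) hg
      _ = η := add_halves η

/- A Cauchy sequence `h` need not be Cauchy for the complete metric given by topological
completeness, but its right translate by a generic `g` is, because `h n * g` comes near a point
where the two metrics are comparable at the given scale. -/
theorem completeSpace_of_isIsometricSMul [IsCompletelyMetrizableSpace H] : CompleteSpace H := by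
  refine UniformSpace.complete_of_cauchySeq_tendsto fun h hh => ?_
  obtain ⟨Z, _, _, ⟨e⟩⟩ : ∃ (Z : Type _) (_ : MetricSpace Z) (_ : CompleteSpace Z),
      Nonempty (H ≃ₜ Z) :=
    let m := upgradeIsCompletelyMetrizable H
    ⟨H, m.toMetricSpace, m.toCompleteSpace, ⟨Homeomorph.refl H⟩⟩
  have hgeneric : ∀ᶠ g in residual H, ∀ i : ℕ, ∃ z, ∀ᶠ n in atTop,
      dist (e (h n * g)) z < 1 / (i + 1) :=
    eventually_countable_forall.2 fun i =>
      eventually_residual_exists_dist_lt_of_cauchySeq e.continuous hh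
        Nat.one_div_pos_of_nat
  obtain ⟨g, hg⟩ := (dense_of_mem_residual hgeneric).nonempty
  have hcauchy : CauchySeq fun n => e (h n * g) := by
    refine Metric.cauchySeq_iff.2 fun ε hε => ?_
    obtain ⟨i, hi⟩ := exists_nat_one_div_lt (half_pos hε)
    obtain ⟨z, hz⟩ := hg i
    obtain ⟨N, hN⟩ := eventually_atTop.1 hz
    refine ⟨N, fun m hm n hn => ?_⟩
    linarith [dist_triangle_right (e (h m * g)) (e (h n * g)) z, hN m hm, hN n hn]
  obtain ⟨z, hz⟩ := cauchySeq_tendsto_of_complete hcauchy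
  have hlim : Tendsto (fun n => h n * g) atTop (𝓝 (e.symm z)) := by
    simpa [Function.comp_def] using (e.symm.continuous.tendsto z).comp hz
  refine ⟨e.symm z * g⁻¹, ?_⟩
  simpa [Function.comp_def] using ((isometry_mul_right g⁻¹).continuous.tendsto _).comp hlim

end CompleteSpace

theorem exists_measurableEquiv_continuous_symm.{u, v} {X : Type u} {Z : Type v}
    [TopologicalSpace X] [PolishSpace X] [MeasurableSpace X] [BorelSpace X]
    [TopologicalSpace Z] [SecondCountableTopology Z] [MeasurableSpace Z] [OpensMeasurableSpace Z]
    {θ : X → Z} (hθ : Measurable θ) :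
    ∃ (Y : Type u) (_ : MetricSpace Y) (_ : CompleteSpace Y) (_ : SecondCountableTopology Y)
      (_ : MeasurableSpace Y) (_ : BorelSpace Y) (f : X ≃ᵐ Y),
      Continuous f.symm ∧ Continuous (θ ∘ f.symm) := by
  obtain ⟨t, hle, hθt, ht⟩ := hθ.exists_continuous
  let m := @upgradeIsCompletelyMetrizable X t inferInstance
  have hborel : ‹MeasurableSpace X› = @borel X t :=
    BorelSpace.measurable_eq.trans (MeasureTheory.borel_eq_borel_of_le ht ‹_› hle).symm
  refine ⟨X, m.toMetricSpace, m.toCompleteSpace, ht.toSecondCountableTopology, ‹_›, ⟨hborel⟩,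
    MeasurableEquiv.refl X, ?_, ?_⟩
  · exact continuous_id_iff_le.2 hle
  · exact hθt

theorem inducedSetoid_mul_left_of_tendsto {G : Type*} [Group G] [TopologicalSpace G]
    [IsTopologicalGroup G] {a : ℕ → G} {g : G} (ha : Tendsto a atTop (𝓝 g)) (x : ℕ → G) :
    inducedSetoid G (a * x) x :=
  ⟨g, by simpa using ha⟩

/-- The sequence which is `1` before `M` and `h` from `M` on. -/
def constFrom {G : Type*} [One G] (M : ℕ) (h : G) (n : ℕ) : G :=
  if M ≤ n then h else 1

section constFrom

variable {G : Type*}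

theorem constFrom_of_le [One G] {M n : ℕ} (hn : M ≤ n) (h : G) : constFrom M h n = h :=
  if_pos hn

theorem constFrom_of_lt [One G] {M n : ℕ} (hn : n < M) (h : G) : constFrom M h n = 1 :=
  if_neg hn.not_ge

theorem tendsto_constFrom [One G] [TopologicalSpace G] (M : ℕ) (h : G) :
    Tendsto (constFrom M h) atTop (𝓝 h) :=
  tendsto_const_nhds.congr' <| (eventually_ge_atTop M).mono fun _ hn => (constFrom_of_le hn h).symm

theorem mulSingle_conj_mul_constFrom_mul [Group G] {M n : ℕ} (hn : M ≤ n) (g h : G)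
    (x : ℕ → G) :
    Pi.mulSingle n (h * g * h⁻¹) * (constFrom M h * x) =
      constFrom M h * (Pi.mulSingle n g * x) := by
  ext k
  rcases eq_or_ne k n with rfl | hk
  · simp [constFrom_of_le hn, mul_assoc]
  · simp [Pi.mulSingle_eq_of_ne hk]

end constFrom

/-- Passing from `x` to `x'` changes every coordinate of the value of `θ`, and the value of `f`,
by at most `ε`. -/
def SmallMove {X Y H : Type*} [Dist H] [Dist Y] (θ : X → ℕ → H) (f : X → Y) (ε : ℝ)
    (x x' : X) : Prop :=
  (∀ k, dist (θ x k) (θ x' k) ≤ ε) ∧ dist (f x) (f x') ≤ ε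

section SmallMove

variable {X Y H : Type*} [PseudoMetricSpace H] [PseudoMetricSpace Y] {θ : X → ℕ → H} {f : X → Y}

theorem SmallMove.mono {ε δ : ℝ} {x x' : X} (h : SmallMove θ f ε x x') (hεδ : ε ≤ δ) :
    SmallMove θ f δ x x' :=
  ⟨fun k => (h.1 k).trans hεδ, h.2.trans hεδ⟩

theorem SmallMove.of_tailClose [Group H] [IsIsometricSMul Hᵐᵒᵖ H] {K : ℕ} {ε δ : ℝ} {x x' : X}
    (htail : TailClose K ε (θ x) (θ x'))
    (hinit : dist (fun k : Fin (K + 1) => θ x k, f x) (fun k : Fin (K + 1) => θ x' k, f x') ≤ δ) :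
    SmallMove θ f (ε + δ) x x' := by
  have hε : 0 ≤ ε := dist_nonneg.trans (htail K le_rfl K le_rfl)
  obtain ⟨hinit, hf⟩ := max_le_iff.1 hinit
  exact ⟨htail.dist_le fun k hk => (dist_le_pi_dist (fun k : Fin (K + 1) => θ x k) _
    ⟨k, Nat.lt_succ_of_le hk⟩).trans hinit, hf.trans (le_add_of_nonneg_left hε)⟩

theorem measurableSet_smallMove [MeasurableSpace X] [SecondCountableTopology H]
    [MeasurableSpace H] [BorelSpace H] [SecondCountableTopology Y] [MeasurableSpace Y]
    [BorelSpace Y] (hθ : Measurable θ) (hf : Measurable f) (ε : ℝ) {a : X → X}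
    (ha : Measurable a) : MeasurableSet {x | SmallMove θ f ε x (a x)} := by
  simp only [SmallMove, Set.ofPred_and, Set.ofPred_forall]
  exact (MeasurableSet.iInter fun k => measurableSet_le ((measurable_pi_iff.1 hθ k).dist
    (measurable_pi_iff.1 (hθ.comp ha) k)) measurable_const).inter
    (measurableSet_le (hf.dist (hf.comp ha)) measurable_const)

end SmallMove

section Homomorphism

variable {G H : Type*} [Group G] [TopologicalSpace G] [IsTopologicalGroup G] [PolishSpace G]
  [MeasurableSpace G] [BorelSpace G]
  [Group H] [MetricSpace H] [IsIsometricSMul H H] [IsIsometricSMul Hᵐᵒᵖ H]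
  [IsTopologicalGroup H] [SecondCountableTopology H] [MeasurableSpace H] [BorelSpace H]
  {θ : (ℕ → G) → ℕ → H}

theorem exists_open_tailClose_mulSingle (hθ : Measurable θ)
    (hom : ∀ x y, inducedSetoid G x y → inducedSetoid H (θ x) (θ y))
    {ε : ℝ} (hε : 0 < ε) {V : Set (ℕ → G)} (hV : IsOpen V) (hne : V.Nonempty) :
    ∃ K, ∃ W ⊆ V, IsOpen W ∧ W.Nonempty ∧ ∀ᶠ g in 𝓝 (1 : G), ∀ n,
      ∀ᶠ x in residual (ℕ → G), x ∈ W → TailClose K ε (θ x) (θ (Pi.mulSingle n g * x)) := by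
  borelize (ConvergentSeq G)
  let μ : ConvergentSeq G × (ℕ → G) → ℕ → G := fun p => p.1.toSeq * p.2
  have hμ : Continuous μ := ConvergentSeq.continuous_toSeq_mul
  have hμo : IsOpenMap μ := ConvergentSeq.isOpenMap_toSeq_mul
  obtain ⟨K, B, hBV, hB, ⟨⟨c, x⟩, hcx⟩, hgeneric⟩ := exists_open_generic_tailClose
    (hθ.comp hμ.measurable) (hθ.comp measurable_snd)
    (fun p => hom _ _ (inducedSetoid_mul_left_of_tendsto p.1.tendsto_toSeq p.2))
    (half_pos hε) (hV.preimage hμ) (hne.preimage fun x => ⟨(1, x), by simp [μ]⟩)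
  have htranslate : Continuous fun q : ConvergentSeq G × ConvergentSeq G × (ℕ → G) =>
      (q.1, 1) * q.2 := by fun_prop
  obtain ⟨R, Q, hR, hQ, hR1, hQcx, hRQ⟩ :=
    isOpen_prod_iff.1 (hB.preimage htranslate) 1 (c, x) (by simpa [← Prod.one_eq_mk] using hcx)
  have hQB : Q ⊆ B := fun p hp => by
    simpa [← Prod.one_eq_mk] using hRQ (Set.mk_mem_prod hR1 hp)
  refine ⟨K, μ '' Q, Set.image_subset_iff.2 (hQB.trans hBV), hμo Q hQ, ⟨_, (c, x), hQcx, rfl⟩, ?_⟩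
  filter_upwards [ConvergentSeq.eventually_mulSingle_mem (hR.mem_nhds hR1)] with g hg n
  have hmeas : MeasurableSet {x | TailClose K ε (θ x) (θ (Pi.mulSingle n g * x))} :=
    measurableSet_tailClose hθ (hθ.comp (measurable_const_mul _)) K ε
  refine eventually_residual_image_of_isOpenMap hμ hμo hmeas.baireMeasurableSet hQ ?_
  filter_upwards [hgeneric, eventually_residual_mul_left hgeneric (ConvergentSeq.mulSingle n g, 1)]
    with p hp hgp hpQ
  have hbase : TailClose K (ε / 2) (θ (μ p)) (θ p.2) := hp (hQB hpQ)
  have hmoved : TailClose K (ε / 2) (θ (Pi.mulSingle n g * μ p)) (θ p.2) := by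
    simpa [μ, mul_assoc, ConvergentSeq.toSeq_mulSingle]
      using hgp (hRQ (Set.mk_mem_prod (hg n) hpQ))
  simpa using hbase.trans hmoved.symm

theorem exists_open_tailClose_conj (hθ : Measurable θ)
    (hom : ∀ x y, inducedSetoid G x y → inducedSetoid H (θ x) (θ y)) {w : ℕ → G}
    (hw : ∀ O ∈ 𝓝 (1 : G), ∃ j, ∃ g ∈ O, IsConj g (w j)) (M : ℕ)
    {ε : ℝ} (hε : 0 < ε) {V : Set (ℕ → G)} (hV : IsOpen V) (hne : V.Nonempty) :
    ∃ j g h, h * g * h⁻¹ = w j ∧ ∃ K, ∃ W ⊆ V, IsOpen W ∧ W.Nonempty ∧ ∀ n,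
      ∀ᶠ x in residual (ℕ → G), x ∈ W → Pi.mulSingle n g * x ∈ W →
        TailClose K ε (θ (constFrom M h * x)) (θ (constFrom M h * (Pi.mulSingle n g * x))) := by
  obtain ⟨K₀, W₀, hW₀V, hW₀, hW₀ne, hmove⟩ :=
    exists_open_tailClose_mulSingle hθ hom (div_pos hε three_pos) hV hne
  obtain ⟨j, g, hg, hconj⟩ := hw _ hmove
  obtain ⟨h, hh⟩ := isConj_iff.1 hconj
  obtain ⟨K₁, W₁, hW₁W₀, hW₁, hW₁ne, htranslate⟩ := exists_open_generic_tailClose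
    (u := fun x => θ (constFrom M h * x)) (hθ.comp (measurable_const_mul _)) hθ
    (fun x => hom _ _ (inducedSetoid_mul_left_of_tendsto (tendsto_constFrom M h) x))
    (div_pos hε three_pos) hW₀ hW₀ne
  refine ⟨j, g, h, hh, max (max K₁ K₀) K₁, W₁, hW₁W₀.trans hW₀V, hW₁, hW₁ne, fun n => ?_⟩
  filter_upwards [hg n, htranslate, eventually_residual_mul_left htranslate (Pi.mulSingle n g)]
    with x hx hτx hτgx hxW hgxW
  convert ((hτx hxW).trans (hx (hW₁W₀ hxW))).trans (hτgx hgxW).symm using 1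
  ring

variable {Y : Type*} [PseudoMetricSpace Y] [SecondCountableTopology Y] [MeasurableSpace Y]
  [BorelSpace Y] {f : (ℕ → G) → Y}

theorem exists_open_smallMove_conj (hθ : Measurable θ)
    (hom : ∀ x y, inducedSetoid G x y → inducedSetoid H (θ x) (θ y)) (hf : Measurable f)
    {w : ℕ → G} (hw : ∀ O ∈ 𝓝 (1 : G), ∃ j, ∃ g ∈ O, IsConj g (w j)) (M : ℕ)
    {ε : ℝ} (hε : 0 < ε) {V : Set (ℕ → G)} (hV : IsOpen V) (hne : V.Nonempty) :
    ∃ j g h, h * g * h⁻¹ = w j ∧ ∃ W ⊆ V, IsOpen W ∧ W.Nonempty ∧ ∀ n,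
      ∀ᶠ x in residual (ℕ → G), x ∈ W → Pi.mulSingle n g * x ∈ W →
        SmallMove θ f ε (constFrom M h * x) (constFrom M h * (Pi.mulSingle n g * x)) := by
  obtain ⟨j, g, h, hh, K, W₀, hW₀V, hW₀, hW₀ne, htail⟩ :=
    exists_open_tailClose_conj hθ hom hw M (half_pos hε) hV hne
  let τ := constFrom M h
  have hτ : Measurable fun x : ℕ → G => τ * x := measurable_const_mul τ
  let init : (ℕ → G) → (Fin (K + 1) → H) × Y := fun x => (fun k => θ (τ * x) k, f (τ * x))
  have hinit : Measurable init :=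
    (measurable_pi_lambda (fun x (k : Fin (K + 1)) => θ (τ * x) k) fun k =>
      measurable_pi_iff.1 (hθ.comp hτ) k).prodMk (hf.comp hτ)
  obtain ⟨y, W, hWW₀, hW, hWne, hosc⟩ :=
    exists_open_generic_dist_le hinit (half_pos (half_pos hε)) hW₀ hW₀ne
  refine ⟨j, g, h, hh, W, hWW₀.trans hW₀V, hW, hWne, fun n => ?_⟩
  filter_upwards [htail n, hosc, eventually_residual_mul_left hosc (Pi.mulSingle n g)]
    with x hx hyx hygx hxW hgxW
  have hdist : dist (init x) (init (Pi.mulSingle n g * x)) ≤ ε / 2 := by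
    simpa using (dist_triangle_right _ _ y).trans (add_le_add (hyx hxW) (hygx hgxW))
  simpa using SmallMove.of_tailClose (hx (hWW₀ hxW) (hWW₀ hgxW)) hdist

theorem exists_open_generic_smallMove (hθ : Measurable θ)
    (hom : ∀ x y, inducedSetoid G x y → inducedSetoid H (θ x) (θ y)) (hf : Measurable f)
    {w : ℕ → G} (hw : ∀ O ∈ 𝓝 (1 : G), ∃ j, ∃ g ∈ O, IsConj g (w j)) (N : ℕ)
    {ε : ℝ} (hε : 0 < ε) {V : Set (ℕ → G)} (hV : IsOpen V) (hne : V.Nonempty) :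
    ∃ n ≥ N, ∃ j, ∃ W ⊆ V, IsOpen W ∧ W.Nonempty ∧
      ∀ᶠ x in residual (ℕ → G), x ∈ W → SmallMove θ f ε x (Pi.mulSingle n (w j) * x) := by
  obtain ⟨V₁, hV₁V, hV₁, hV₁ne, N₁, hN₁⟩ := exists_open_subset_dependsOn_Iio hV hne
  let M := max N N₁
  obtain ⟨j, g, h, hh, W₂, hW₂V₁, hW₂, hW₂ne, hmove⟩ :=
    exists_open_smallMove_conj hθ hom hf hw M hε hV₁ hV₁ne
  obtain ⟨W₃, hW₃W₂, hW₃, ⟨x₃, hx₃⟩, N₃, hN₃⟩ := exists_open_subset_dependsOn_Iio hW₂ hW₂ne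
  let n := max M N₃
  let τ := constFrom M h
  refine ⟨n, (le_max_left _ _).trans (le_max_left _ _), j, (τ⁻¹ * ·) ⁻¹' W₃, fun x hx => ?_,
    hW₃.preimage (continuous_const_mul _), ⟨τ * x₃, by simpa using hx₃⟩, ?_⟩
  · have hagree : ∀ k ∈ Set.Iio N₁, (τ⁻¹ * x) k = x k := fun k hk => by
      have hkM : k < M := lt_max_of_lt_right hk
      simp [τ, constFrom_of_lt hkM]
    exact hV₁V ((hN₁ hagree).mp (hW₂V₁ (hW₃W₂ hx)))
  · filter_upwards [eventually_residual_mul_left (hmove n) τ⁻¹] with x hx hxW₃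
    let s : ℕ → G := Pi.mulSingle n g
    have hagree : ∀ k ∈ Set.Iio N₃, (τ⁻¹ * x) k = (s * (τ⁻¹ * x)) k := fun k hk => by
      have hkn : k < n := lt_max_of_lt_right hk
      simp [s, Pi.mulSingle_eq_of_ne hkn.ne]
    have hsmall := hx (hW₃W₂ hxW₃) (hW₃W₂ ((hN₃ hagree).mp hxW₃))
    rwa [← mulSingle_conj_mul_constFrom_mul (le_max_left M N₃), hh, mul_inv_cancel_left] at hsmall

theorem eventually_residual_exists_smallMove (hθ : Measurable θ)
    (hom : ∀ x y, inducedSetoid G x y → inducedSetoid H (θ x) (θ y)) (hf : Measurable f)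
    {w : ℕ → G} (hw : ∀ O ∈ 𝓝 (1 : G), ∃ j, ∃ g ∈ O, IsConj g (w j)) :
    ∀ᶠ x in residual (ℕ → G), ∀ ε > 0, ∀ N, ∃ n ≥ N, ∃ j,
      SmallMove θ f ε x (Pi.mulSingle n (w j) * x) := by
  have hgeneric : ∀ i N : ℕ, ∀ᶠ x in residual (ℕ → G), ∃ n ≥ N, ∃ j,
      SmallMove θ f ((1 / 2) ^ i) x (Pi.mulSingle n (w j) * x) := by
    intro i N
    refine eventually_residual_of_forall_open (MeasurableSet.baireMeasurableSet ?_)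
      fun V hV hne => ?_
    · simp only [Set.ofPred_exists, Set.ofPred_and]
      exact MeasurableSet.iUnion fun n => (MeasurableSet.const _).inter <|
        MeasurableSet.iUnion fun j => measurableSet_smallMove hθ hf _ (measurable_const_mul _)
    · obtain ⟨n, hn, j, W, hWV, hW, hWne, hmove⟩ :=
        exists_open_generic_smallMove hθ hom hf hw N (by positivity : (0 : ℝ) < (1 / 2) ^ i) hV hne
      exact ⟨W, hWV, hW, hWne, hmove.mono fun x hx hxW => ⟨n, hn, j, hx hxW⟩⟩
  filter_upwards [eventually_countable_forall.2 fun i =>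
    eventually_countable_forall.2 (hgeneric i)] with x hx ε hε N
  obtain ⟨i, hi⟩ := exists_pow_lt_of_lt_one hε one_half_lt_one
  obtain ⟨n, hn, j, hmove⟩ := hx i N
  exact ⟨n, hn, j, hmove.mono hi.le⟩

end Homomorphism

section SparseModification

variable {G : Type*} [Group G]

theorem apply_eq_apply_of_mulSingle_mul {n : ℕ → ℕ} {v : ℕ → G} {x : ℕ → ℕ → G}
    (hx : ∀ i, x (i + 1) = Pi.mulSingle (n i) (v i) * x i) {a b k : ℕ} (hab : a ≤ b)
    (hk : ∀ i, a ≤ i → i < b → n i ≠ k) : x b k = x a k := by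
  induction b, hab using Nat.le_induction with
  | base => rfl
  | succ b hab ih =>
    rw [hx, Pi.mul_apply, Pi.mulSingle_eq_of_ne (hk b hab b.lt_succ_self).symm, one_mul]
    exact ih fun i hai hib => hk i hai (hib.trans b.lt_succ_self)

variable [TopologicalSpace G]

theorem limit_apply_eq_apply_of_mulSingle_mul [T2Space G] {n : ℕ → ℕ} {v : ℕ → G}
    {x : ℕ → ℕ → G} (hx : ∀ i, x (i + 1) = Pi.mulSingle (n i) (v i) * x i) {y : ℕ → G}
    (hy : Tendsto x atTop (𝓝 y)) {a k : ℕ} (hk : ∀ i ≥ a, n i ≠ k) : y k = x a k := by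
  refine tendsto_nhds_unique (tendsto_pi_nhds.1 hy k) (tendsto_const_nhds.congr' ?_)
  filter_upwards [eventually_ge_atTop a] with b hab
  exact (apply_eq_apply_of_mulSingle_mul hx hab fun i hai _ => hk i hai).symm

theorem limit_apply_eq_mul_of_mulSingle_mul [T2Space G] {n : ℕ → ℕ} (hn : n.Injective)
    {v : ℕ → G} {x : ℕ → ℕ → G} (hx : ∀ i, x (i + 1) = Pi.mulSingle (n i) (v i) * x i)
    {y : ℕ → G} (hy : Tendsto x atTop (𝓝 y)) (i : ℕ) : y (n i) = v i * x 0 (n i) := by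
  rw [limit_apply_eq_apply_of_mulSingle_mul hx hy (a := i + 1) fun j hj => hn.ne (by lia), hx,
    Pi.mul_apply, Pi.mulSingle_eq_same,
    apply_eq_apply_of_mulSingle_mul hx i.zero_le fun j _ hj => hn.ne hj.ne]

theorem strictMono_of_add_two_le {n : ℕ → ℕ} (hn : ∀ i, n i + 2 ≤ n (i + 1)) : StrictMono n :=
  strictMono_nat_of_lt_succ fun i => (Nat.lt_add_of_pos_right two_pos).trans_le (hn i)

theorem not_inducedSetoid_of_sparse [IsTopologicalGroup G] [T2Space G] {U : Set G}
    (hU : U ∈ 𝓝 1) {n : ℕ → ℕ} (hn : ∀ i, n i + 2 ≤ n (i + 1)) {x y : ℕ → G}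
    (hy : ∀ i, y (n i) * (x (n i))⁻¹ ∉ U) (hyx : ∀ k ∉ Set.range n, y k = x k) :
    ¬ inducedSetoid G y x := by
  rintro ⟨c, hc⟩
  have hmono := strictMono_of_add_two_le hn
  have hgap : ∀ i, n i + 1 ∉ Set.range n := by
    rintro i ⟨j, hj⟩
    rcases le_or_gt j i with hji | hij
    · have := hmono.monotone hji
      lia
    · have := (hn i).trans (hmono.monotone hij)
      lia
  have hc1 : c = 1 := by
    refine tendsto_nhds_unique
      (hc.comp ((tendsto_add_atTop_nat 1).comp hmono.tendsto_atTop))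
      (tendsto_const_nhds.congr fun i => ?_)
    simp [hyx _ (hgap i)]
  obtain ⟨i, hi⟩ := ((hc.comp hmono.tendsto_atTop).eventually_mem (hc1 ▸ hU)).exists
  exact hy i hi

end SparseModification

section Limit

theorem exists_seq_smallMove {G Y H : Type*} [Group G] [Dist H] [Dist Y]
    {θ : (ℕ → G) → ℕ → H} {f : (ℕ → G) → Y} {w : ℕ → G} {S : Set (ℕ → G)}
    (hmove : ∀ x ∈ S, ∀ ε > 0, ∀ N, ∃ n ≥ N, ∃ j,
      SmallMove θ f ε x (Pi.mulSingle n (w j) * x))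
    (hmul : ∀ x ∈ S, ∀ n j, Pi.mulSingle n (w j) * x ∈ S)
    {ε : ℕ → ℝ} (hε : ∀ i, 0 < ε i) {x₀ : ℕ → G} (hx₀ : x₀ ∈ S) :
    ∃ (x : ℕ → ℕ → G) (n j : ℕ → ℕ), x 0 = x₀ ∧ (∀ i, n i + 2 ≤ n (i + 1)) ∧
      (∀ i, x (i + 1) = Pi.mulSingle (n i) (w (j i)) * x i) ∧
      ∀ i, SmallMove θ f (ε i) (x i) (x (i + 1)) := by
  choose! pos hpos idx hsmall using hmove
  let state : ℕ → (ℕ → G) × ℕ := fun i => Nat.rec (x₀, 0) (fun i a =>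
    (Pi.mulSingle (pos a.1 (ε i) a.2) (w (idx a.1 (ε i) a.2)) * a.1, pos a.1 (ε i) a.2 + 2)) i
  have hS : ∀ i, (state i).1 ∈ S := fun i => by
    induction i with
    | zero => exact hx₀
    | succ i ih => exact hmul _ ih _ _
  exact ⟨fun i => (state i).1, fun i => pos (state i).1 (ε i) (state i).2,
    fun i => idx (state i).1 (ε i) (state i).2, rfl,
    fun i => hpos _ (hS (i + 1)) _ (hε (i + 1)) _, fun i => rfl,
    fun i => hsmall _ (hS i) _ (hε i) _⟩

theorem exists_tendsto_of_smallMove {X Y H : Type*} [TopologicalSpace X] [MetricSpace Y]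
    [CompleteSpace Y] [PseudoMetricSpace H] {θ : X → ℕ → H} (f : X ≃ Y) (hf : Continuous f.symm)
    (hθf : Continuous (θ ∘ f.symm)) {x : ℕ → X}
    (hx : ∀ i, SmallMove θ f (1 / 2 / 2 ^ i) (x i) (x (i + 1))) :
    ∃ y, Tendsto x atTop (𝓝 y) ∧ ∀ i k, dist (θ (x i) k) (θ y k) ≤ 1 / 2 ^ i := by
  obtain ⟨z, hz⟩ := cauchySeq_tendsto_of_complete (cauchySeq_of_le_geometric_two fun i => (hx i).2)
  have hθz : Tendsto (fun i => θ (x i)) atTop (𝓝 (θ (f.symm z))) := by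
    simpa [Function.comp_def] using (hθf.tendsto z).comp hz
  exact ⟨f.symm z, by simpa [Function.comp_def] using (hf.tendsto z).comp hz, fun i k =>
    dist_le_of_le_geometric_two_of_tendsto (fun i => (hx i).1 k) (tendsto_pi_nhds.1 hθz k) i⟩

variable {G H : Type*} [Group G] [TopologicalSpace G] [IsTopologicalGroup G] [PolishSpace G]
  [MeasurableSpace G] [BorelSpace G]
  [Group H] [MetricSpace H] [IsIsometricSMul H H] [IsIsometricSMul Hᵐᵒᵖ H]
  [IsTopologicalGroup H] [PolishSpace H] [MeasurableSpace H] [BorelSpace H]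

theorem exists_inducedSetoid_sparse_modification {θ : (ℕ → G) → ℕ → H} (hθ : Measurable θ)
    (hom : ∀ x y, inducedSetoid G x y → inducedSetoid H (θ x) (θ y)) {w : ℕ → G}
    (hw : ∀ O ∈ 𝓝 (1 : G), ∃ j, ∃ g ∈ O, IsConj g (w j)) :
    ∃ (x y : ℕ → G) (n j : ℕ → ℕ), (∀ i, n i + 2 ≤ n (i + 1)) ∧
      (∀ i, y (n i) = w (j i) * x (n i)) ∧ (∀ k ∉ Set.range n, y k = x k) ∧
      inducedSetoid H (θ y) (θ x) := by
  obtain ⟨Y, _, _, _, _, _, f, hf, hθf⟩ := exists_measurableEquiv_continuous_symm hθ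
  obtain ⟨S, hS, hmove, hmul⟩ := exists_residual_subset_mul_left_mem
    (eventually_residual_exists_smallMove hθ hom f.measurable hw)
    fun p : ℕ × ℕ => Pi.mulSingle p.1 (w p.2)
  obtain ⟨x₀, hx₀⟩ := (dense_of_mem_residual hS).nonempty
  obtain ⟨x, n, j, rfl, hn, hx, hsmall⟩ := exists_seq_smallMove hmove
    (fun x hx n j => hmul (n, j) x hx) (fun i => by positivity : ∀ i, (0 : ℝ) < 1 / 2 / 2 ^ i) hx₀
  obtain ⟨y, hxy, hdist⟩ := exists_tendsto_of_smallMove f.toEquiv hf hθf hsmall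
  have hE : ∀ i, inducedSetoid G (x i) (x 0) := fun i => by
    induction i with
    | zero => exact (inducedSetoid G).refl _
    | succ i ih =>
      rw [hx]
      exact (inducedSetoid G).trans (inducedSetoid_mul_left_of_tendsto
        (ConvergentSeq.tendsto_toSeq (ConvergentSeq.mulSingle _ _)) _) ih
  have : CompleteSpace H := completeSpace_of_isIsometricSMul
  refine ⟨x 0, y, n, j, hn,
    limit_apply_eq_mul_of_mulSingle_mul (strictMono_of_add_two_le hn).injective hx hxy,
    fun k hk => limit_apply_eq_apply_of_mulSingle_mul hx hxy fun i _ hik => hk ⟨i, hik⟩,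
    inducedSetoid_of_forall_exists_dist_le fun ε hε => ?_⟩
  obtain ⟨i, hi⟩ := exists_pow_lt_of_lt_one hε one_half_lt_one
  exact ⟨θ (x i), hom _ _ (hE i), fun k => (hdist i k).trans (by simpa using hi.le)⟩

end Limit

theorem theorem3 {G : Type*} {H : Type*}
    [Group G] [TopologicalSpace G] [IsTopologicalGroup G] [PolishSpace G]
    [Group H] [TopologicalSpace H] [IsTopologicalGroup H] [PolishSpace H]
    (hH : IsTSI H) (hG : ¬ IsTSI G) :
    ¬ BorelReducible (inducedSetoid G) (inducedSetoid H) := by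
  rintro ⟨θ, hθ, hred⟩
  obtain ⟨U, hU, w, hwU, hw⟩ := exists_seq_isConj_of_not_isTSI hG
  obtain ⟨m, rfl, hleft, hright⟩ := hH
  have : IsIsometricSMul H H := ⟨fun g => Isometry.of_dist_eq (hleft g)⟩
  have : IsIsometricSMul Hᵐᵒᵖ H := ⟨fun g => Isometry.of_dist_eq (hright g.unop)⟩
  borelize G H
  have hθ_pi : Measurable θ := by
    rwa [← BorelSpace.measurable_eq, ← BorelSpace.measurable_eq] at hθ
  obtain ⟨x, y, n, j, hn, hy, hyx, hE⟩ :=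
    exists_inducedSetoid_sparse_modification hθ_pi (fun x y => (hred x y).1) hw
  exact not_inducedSetoid_of_sparse hU hn (fun i => by simpa [hy i] using hwU (j i)) hyx
    ((hred y x).2 hE)
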